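/- **Setting.** Let $d\ge 1$ be an integer, $h_{\max}>0$, and let $\|\cdot\|$ be the Euclidean norm on $\mathbb R^d$ and the Frobenius norm $\|M\|=(\sum_{i,j}|M_{i,j}|^2)^{1/2}$ on the space $\mathcal M_d(\mathbb R)$ of real $d\times d$ matrices. Let $F:\mathbb R^d\to\mathbb R$ be of class $\mathcal C^3$ with bounded third order derivative, and assume that there exist $L_F,\mu\in(0,\infty)$ such that for all $x_1,x_2\in\mathbb R^d$ $$\|\nabla F(x_2)-\nabla F(x_1)\|\le L_F\|x_2-x_1\|,\qquad \langle\nabla F(x_2)-\nabla F(x_1),x_2-x_1\rangle\ge\mu\|x_2-x_1\|^2 .$$ Let $x^\star$ be the unique minimizer of $F$. Let $\sigma:[0,\infty)\times\mathbb R^d\to\mathcal M_d(\mathbb R)$ be continuous, and assume that there is a bounded function $\varsigma:[0,\infty)\to[0,\infty)$ such that for all $t\ge 0$ and $x_1,x_2\in\mathbb R^d$ $$\|\sigma(t,x_2)-\sigma(t,x_1)\|\le\varsigma(t)\|x_2-x_1\|,\qquad \sup_{x\in\mathbb R^d}\frac{\|\sigma(t,x)\|}{1+\|x-x^\star\|}\le\varsigma(t).$$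 For $h>0$ and $x_0\in\mathbb R^d$, let $(X_n)_{n\ge0}$ be defined by $X_0=x_0$ and $$X_{n+1}=X_n-h\nabla F(X_n)+h\,\sigma(nh,X_n)\gamma_{n+1},\qquad n\ge 0,$$ where $(\gamma_n)_{n\ge1}$ are independent standard centered Gaussian random vectors in $\mathbb R^d$, and let $\mathcal X^0$ be the solution on $[0,\infty)$ of $\frac{d}{dt}\mathcal X^0(t)=-\nabla F(\mathcal X^0(t))$, $\mathcal X^0(0)=x_0$. For $\varphi:\mathbb R^d\to\mathbb R$ of class $\mathcal C^2$ set $$|||\varphi|||_2=\sup_{x\in\mathbb R^d}\ \sup_{k_1,k_2\in\mathbb R^d\setminus\{0\}}\frac{|D^2\varphi(x).(k_1,k_2)|}{\|k_1\|\|k_2\|}.$$ **Proposition.** There exist $H\in(0,h_{\max})$ and $C\in(0,\infty)$ such that for every $\varphi:\mathbb R^d\to\mathbb R$ of class $\mathcal C^2$ with bounded second order derivative, every $x_0\in\mathbb R^d$ and every $h\in(0,H)$, the random variables $\varphi(X_N)$, $N\ge1$, are integrable and $$\sup_{N\ge1}\bigl|\mathbb E[\varphi(X_N)]-\varphi(\mathcal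 X^0(Nh))\bigr|\le C_1(\varphi,x_0)\,h,$$ where $$C_1(\varphi,x_0)=C\bigl(\|\nabla\varphi(x^\star)\|+|||\varphi|||_2\bigr)\bigl(1+\|x_0-x^\star\|^3\bigr).$$ The numbers $H$ and $C$ depend only on $d$, $h_{\max}$, $F$ and $\sigma$; in particular they do not depend on $\varphi$, $x_0$, $h$, $N$, or on the choice of the probability space and of the Gaussian vectors. -/

import Mathlib

open MeasureTheory ProbabilityTheory

noncomputable section

namespace StochGradScheme

/-- The Euclidean space `ℝ^d`. -/
abbrev E (d : ℕ) : Type := EuclideanSpace ℝ (Fin d)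

variable {d : ℕ}

/-- The norm `‖M‖ = (∑_{i,j} |M_{i,j}|²)^{1/2}` on square matrices. -/
def frobNorm (M : Matrix (Fin d) (Fin d) ℝ) : ℝ :=
  Real.sqrt (∑ i, ∑ j, |M i j| ^ 2)

/-- The derivative of order `m` of `φ` is bounded on `ℝ^d`. -/
def BoundedDeriv (m : ℕ) (φ : E d → ℝ) : Prop :=
  ∃ M : ℝ, ∀ x, ‖iteratedFDeriv ℝ m φ x‖ ≤ M

/-- The seminorm `|||φ|||_m`: the supremum over `x` and over nonzero directions `k₁, …, k_m` of
`|D^m φ(x).(k₁, …, k_m)| / (‖k₁‖ ⋯ ‖k_m‖)`. -/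
def tripleNorm (m : ℕ) (φ : E d → ℝ) : ℝ :=
  ⨆ p : E d × (Fin m → {k : E d // k ≠ 0}),
    |iteratedFDeriv ℝ m φ p.1 (fun i => (p.2 i : E d))| / ∏ i, ‖(p.2 i : E d)‖

/-- Basic assumptions on the objective function `F`: class `C³`, globally Lipschitz gradient,
`μ`-convexity for some `μ > 0`, bounded third order derivative. -/
structure ObjectiveAssumption (F : E d → ℝ) : Prop where
  contDiff : ContDiff ℝ 3 F
  lipschitz_gradient : ∃ L : ℝ, 0 < L ∧ ∀ x₁ x₂ : E d,
    ‖gradient F x₂ - gradient F x₁‖ ≤ L * ‖x₂ - x₁‖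
  mu_convex : ∃ μ : ℝ, 0 < μ ∧ ∀ x₁ x₂ : E d,
    μ * ‖x₂ - x₁‖ ^ 2 ≤ inner ℝ (gradient F x₂ - gradient F x₁) (x₂ - x₁)
  bounded_third : BoundedDeriv 3 F

/-- The minimizer `x⋆` of `F`. It exists and is unique under `ObjectiveAssumption F`, see
`minimizer_le` and `eq_minimizer`. -/
def minimizer (F : E d → ℝ) : E d :=
  Classical.epsilon fun x => ∀ y, F x ≤ F y

/-- Basic assumptions on the diffusion coefficient `σ` (only its values at times `t ≥ 0` matter):
joint continuity on `[0,∞) × ℝ^d`, and Lipschitz continuity and linear growth in space with a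
constant `ς(t)` which is bounded in time. -/
structure DiffusionAssumption (F : E d → ℝ) (σ : ℝ → E d → Matrix (Fin d) (Fin d) ℝ) : Prop where
  continuousOn : ContinuousOn (fun p : ℝ × E d => σ p.1 p.2) (Set.Ici 0 ×ˢ Set.univ)
  lipschitz_growth : ∃ ς : ℝ → ℝ,
    (∀ t, 0 ≤ t → 0 ≤ ς t) ∧
    (∀ t, 0 ≤ t → ∀ x₁ x₂ : E d, frobNorm (σ t x₂ - σ t x₁) ≤ ς t * ‖x₂ - x₁‖) ∧
    (∀ t, 0 ≤ t → ∀ x : E d, frobNorm (σ t x) / (1 + ‖x - minimizer F‖) ≤ ς t) ∧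
    BddAbove (ς '' Set.Ici 0)

/-- `X` solves the gradient system `X'(t) = -∇F(X(t))` for `t ≥ 0`, with `X(0) = x`. -/
def IsGradientFlow (F : E d → ℝ) (x : E d) (X : ℝ → E d) : Prop :=
  X 0 = x ∧ ∀ t, 0 ≤ t → HasDerivWithinAt X (-gradient F (X t)) (Set.Ici 0) t

/-- The solution of the gradient system with initial value `x`. Under `ObjectiveAssumption F` it
exists and is unique on `[0,∞)`, see `isGradientFlow_gradientFlow` and `eqOn_gradientFlow`. -/
def gradientFlow (F : E d → ℝ) (x : E d) : ℝ → E d :=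
  Classical.epsilon fun X => IsGradientFlow F x X

/-- The scheme `X_{n+1} = X_n - h ∇F(X_n) + h σ(nh, X_n) γ_{n+1}`, `X_0 = x₀`. The sequence
`(γ_n)_{n ≥ 1}` is indexed from zero: `γ n` is the `(n+1)`-th Gaussian vector. -/
def scheme {Ω : Type*} (F : E d → ℝ) (σ : ℝ → E d → Matrix (Fin d) (Fin d) ℝ) (h : ℝ) (x₀ : E d)
    (γ : ℕ → Ω → E d) : ℕ → Ω → E d
  | 0, _ => x₀
  | n + 1, ω =>
      scheme F σ h x₀ γ n ω - h • gradient F (scheme F σ h x₀ γ n ω)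
        + h • Matrix.toEuclideanLin (σ (n * h) (scheme F σ h x₀ γ n ω)) (γ n ω)

/-- `C₁(φ, x₀) = C (‖∇φ(x⋆)‖ + |||φ|||_2) (1 + ‖x₀ - x⋆‖³)`. -/
def weakConst (F : E d → ℝ) (C : ℝ) (φ : E d → ℝ) (x₀ : E d) : ℝ :=
  C * (‖gradient φ (minimizer F)‖ + tripleNorm 2 φ) * (1 + ‖x₀ - minimizer F‖ ^ 3)

/-! ### The minimizer and the gradient flow are well defined -/

theorem ObjectiveAssumption.hasGradientAt {F : E d → ℝ} (hF : ObjectiveAssumption F) (x : E d) :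
    HasGradientAt F (gradient F x) x :=
  ((hF.contDiff.differentiable (by norm_num)) x).hasGradientAt

theorem ObjectiveAssumption.contDiff_gradient {F : E d → ℝ} (hF : ObjectiveAssumption F) :
    ContDiff ℝ 2 (gradient F) := by
  have h : ContDiff ℝ 2 (fderiv ℝ F) := hF.contDiff.fderiv_right (by norm_num)
  exact (InnerProductSpace.toDual ℝ (E d)).symm.contDiff.comp h

theorem ObjectiveAssumption.exists_gradient_eq_zero {F : E d → ℝ} (hF : ObjectiveAssumption F) :
    ∃ x, gradient F x = 0 := by
  obtain ⟨L, hL, hLip⟩ := hF.lipschitz_gradient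
  obtain ⟨μ, hμ, hconv⟩ := hF.mu_convex
  set s : ℝ := μ / (L ^ 2 + μ ^ 2) with hs
  have hD : 0 < L ^ 2 + μ ^ 2 := by positivity
  have hs0 : 0 < s := by positivity
  have hq0 : 0 ≤ 1 - s * μ := by
    rw [hs, div_mul_eq_mul_div, sub_nonneg, div_le_one hD]
    nlinarith [sq_nonneg L]
  have hq1 : 1 - s * μ < 1 := by nlinarith [mul_pos hs0 hμ]
  have key : ∀ x y : E d, ‖(x - s • gradient F x) - (y - s • gradient F y)‖
      ≤ Real.sqrt (1 - s * μ) * ‖x - y‖ := by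
    intro x y
    have e : (x - s • gradient F x) - (y - s • gradient F y)
        = (x - y) - s • (gradient F x - gradient F y) := by
      rw [smul_sub]; abel
    have h1 := hLip y x
    have h2 := hconv y x
    have h3 : ‖gradient F x - gradient F y‖ ^ 2 ≤ L ^ 2 * ‖x - y‖ ^ 2 := by
      rw [← mul_pow]; gcongr
    have h4 : s * (L ^ 2 + μ ^ 2) = μ := by rw [hs]; field_simp
    have h5 : ‖(x - y) - s • (gradient F x - gradient F y)‖ ^ 2
        ≤ (1 - s * μ) * ‖x - y‖ ^ 2 := by
      rw [norm_sub_sq_real, inner_smul_right, norm_smul, mul_pow, Real.norm_eq_abs, sq_abs,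
        real_inner_comm]
      have h6 : s ^ 2 * L ^ 2 ≤ s * μ := by nlinarith [sq_nonneg (s * μ)]
      have h7 : s ^ 2 * ‖gradient F x - gradient F y‖ ^ 2 ≤ s * μ * ‖x - y‖ ^ 2 :=
        calc s ^ 2 * ‖gradient F x - gradient F y‖ ^ 2
            ≤ s ^ 2 * (L ^ 2 * ‖x - y‖ ^ 2) := by gcongr
          _ = s ^ 2 * L ^ 2 * ‖x - y‖ ^ 2 := by ring
          _ ≤ s * μ * ‖x - y‖ ^ 2 := by gcongr
      have h8 := mul_le_mul_of_nonneg_left h2 hs0.le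
      linarith
    rw [e]
    have h9 := Real.sqrt_le_sqrt h5
    rwa [Real.sqrt_sq (norm_nonneg _), Real.sqrt_mul hq0, Real.sqrt_sq (norm_nonneg _)] at h9
  have hc : ContractingWith (Real.toNNReal (Real.sqrt (1 - s * μ)))
      (fun x : E d => x - s • gradient F x) := by
    refine ⟨?_, LipschitzWith.of_dist_le_mul fun x y => ?_⟩
    · rw [Real.toNNReal_lt_one, Real.sqrt_lt' one_pos]
      linarith
    · rw [dist_eq_norm, dist_eq_norm, Real.coe_toNNReal _ (Real.sqrt_nonneg _)]
      exact key x y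
  refine ⟨ContractingWith.fixedPoint _ hc, ?_⟩
  have hfix := hc.fixedPoint_isFixedPt
  set z := ContractingWith.fixedPoint _ hc
  have h0 : z - s • gradient F z = z := hfix
  have h1 : s • gradient F z = 0 := by
    have := sub_eq_self.mp h0
    exact this
  exact (smul_eq_zero.mp h1).resolve_left hs0.ne'

theorem ObjectiveAssumption.le_of_gradient_eq_zero {F : E d → ℝ} (hF : ObjectiveAssumption F)
    {x : E d} (hx : gradient F x = 0) (y : E d) : F x ≤ F y := by
  obtain ⟨μ, hμ, hconv⟩ := hF.mu_convex
  have hder : ∀ t : ℝ, HasDerivAt (fun t : ℝ => F (x + t • (y - x)))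
      (inner ℝ (gradient F (x + t • (y - x))) (y - x)) t := by
    intro t
    have h1 : HasDerivAt (fun t : ℝ => x + t • (y - x)) (y - x) t := by
      simpa using ((hasDerivAt_id t).smul_const (y - x)).const_add x
    have h2 := (hF.hasGradientAt (x + t • (y - x))).hasFDerivAt.comp_hasDerivAt t h1
    rw [InnerProductSpace.toDual_apply_apply] at h2
    exact h2
  have hmono : MonotoneOn (fun t : ℝ => F (x + t • (y - x))) (Set.Icc 0 1) := by
    refine monotoneOn_of_deriv_nonneg (convex_Icc 0 1)
      (fun t _ => (hder t).continuousAt.continuousWithinAt)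
      (fun t _ => (hder t).differentiableAt.differentiableWithinAt) ?_
    intro t ht
    rw [interior_Icc] at ht
    rw [(hder t).deriv]
    have h3 := hconv x (x + t • (y - x))
    rw [hx, sub_zero, add_sub_cancel_left, inner_smul_right] at h3
    have h4 : 0 ≤ t * inner ℝ (gradient F (x + t • (y - x))) (y - x) :=
      le_trans (by positivity) h3
    exact nonneg_of_mul_nonneg_right h4 ht.1
  have := hmono (Set.left_mem_Icc.mpr zero_le_one) (Set.right_mem_Icc.mpr zero_le_one) zero_le_one
  simpa using this

theorem minimizer_le {F : E d → ℝ} (hF : ObjectiveAssumption F) (y : E d) :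
    F (minimizer F) ≤ F y := by
  obtain ⟨x, hx⟩ := hF.exists_gradient_eq_zero
  exact Classical.epsilon_spec (p := fun x => ∀ y, F x ≤ F y)
    ⟨x, hF.le_of_gradient_eq_zero hx⟩ y

theorem gradient_eq_zero_of_le {F : E d → ℝ} {x : E d} (hx : ∀ y, F x ≤ F y) :
    gradient F x = 0 := by
  have h : IsLocalMin F x := Filter.Eventually.of_forall hx
  rw [gradient, h.fderiv_eq_zero, map_zero]

theorem eq_minimizer {F : E d → ℝ} (hF : ObjectiveAssumption F) {x : E d}
    (hx : ∀ y, F x ≤ F y) : x = minimizer F := by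
  obtain ⟨μ, hμ, hconv⟩ := hF.mu_convex
  have h := hconv (minimizer F) x
  rw [gradient_eq_zero_of_le hx, gradient_eq_zero_of_le (minimizer_le hF), sub_zero,
    inner_zero_left] at h
  have h2 : ‖x - minimizer F‖ ^ 2 = 0 :=
    le_antisymm (nonpos_of_mul_nonpos_right h hμ) (sq_nonneg _)
  exact sub_eq_zero.mp (norm_eq_zero.mp (pow_eq_zero_iff two_ne_zero |>.mp h2))

theorem ObjectiveAssumption.lipschitzWith {F : E d → ℝ} (hF : ObjectiveAssumption F) :
    ∃ K : NNReal, LipschitzWith K (fun x => -gradient F x) := by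
  obtain ⟨L, hL, hLip⟩ := hF.lipschitz_gradient
  refine ⟨⟨L, hL.le⟩, LipschitzWith.of_dist_le_mul fun x y => ?_⟩
  rw [dist_neg_neg, dist_eq_norm, dist_eq_norm]
  exact hLip y x

theorem exists_isGradientFlow {F : E d → ℝ} (hF : ObjectiveAssumption F) (x : E d) :
    ∃ X, IsGradientFlow F x X := by
  obtain ⟨K, hK⟩ := hF.lipschitzWith
  have hε : (0 : ℝ) < 1 / (1 + K) := by positivity
  have hloc : ∀ y : E d, ∃ γ : ℝ → E d, γ 0 = y ∧
      IsMIntegralCurveOn (I := modelWithCornersSelf ℝ (E d)) γ (fun z => -gradient F z)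
        (Set.Ioo (-(1 / (1 + (K : ℝ)))) (1 / (1 + K))) := by
    intro y
    set ε : ℝ := 1 / (1 + K) with hεdef
    have hPL : IsPicardLindelof (fun _ z => -gradient F z)
        (⟨0, by constructor <;> linarith⟩ : Set.Icc (-ε) ε) y
        (‖gradient F y‖₊ + 1) 0 (‖gradient F y‖₊ + K * (‖gradient F y‖₊ + 1)) K := by
      refine ⟨fun _ _ => hK.lipschitzOnWith, fun _ _ => continuousOn_const, ?_, ?_⟩
      · intro _ _ z hz
        have h1 := hK.dist_le_mul z y
        rw [dist_eq_norm] at h1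
        have h2 : dist z y ≤ ‖gradient F y‖ + 1 := by simpa using hz
        have h3 : ‖-gradient F z‖ ≤ ‖-gradient F y‖ + ‖-gradient F z - -gradient F y‖ :=
          norm_le_norm_add_norm_sub' _ _
        rw [norm_neg (gradient F y)] at h3
        have h4 : (K : ℝ) * dist z y ≤ K * (‖gradient F y‖ + 1) := by gcongr
        push_cast
        linarith
      · have e : max (ε - 0) (0 - -ε) = ε := by simp
        push_cast
        rw [e, hεdef, mul_one_div, div_le_iff₀ (by positivity)]
        nlinarith [norm_nonneg (gradient F y), K.coe_nonneg]
    obtain ⟨α, h0, hα⟩ := hPL.exists_eq_forall_mem_Icc_hasDerivWithinAt₀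
    refine ⟨α, h0, fun t ht => ?_⟩
    have h1 := (hα t (Set.Ioo_subset_Icc_self ht)).mono Set.Ioo_subset_Icc_self
    exact h1.hasFDerivWithinAt.hasMFDerivWithinAt
  have hv : ContDiff ℝ 1 (fun z => -gradient F z) :=
    (hF.contDiff_gradient.of_le (by norm_num)).neg
  obtain ⟨γ, h0, hγ⟩ := exists_isMIntegralCurve_of_isMIntegralCurveOn
    (I := modelWithCornersSelf ℝ (E d)) (v := fun z => -gradient F z)
    (contMDiff_vectorSpace_iff_contDiff.mpr hv) hε hloc x
  refine ⟨γ, h0, fun t _ => ?_⟩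
  have h1 : HasFDerivAt γ
      (ContinuousLinearMap.toSpanSingleton ℝ (-gradient F (γ t))) t := by
    refine (hγ t).hasFDerivAt.congr_fderiv ?_
    ext
    rfl
  exact h1.hasDerivAt.hasDerivWithinAt.congr_deriv (by simp)

theorem isGradientFlow_gradientFlow {F : E d → ℝ} (hF : ObjectiveAssumption F) (x : E d) :
    IsGradientFlow F x (gradientFlow F x) :=
  Classical.epsilon_spec (exists_isGradientFlow hF x)

theorem eqOn_gradientFlow {F : E d → ℝ} (hF : ObjectiveAssumption F) {x : E d} {X : ℝ → E d}
    (hX : IsGradientFlow F x X) : Set.EqOn X (gradientFlow F x) (Set.Ici 0) := by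
  obtain ⟨K, hK⟩ := hF.lipschitzWith
  have hG := isGradientFlow_gradientFlow hF x
  intro t ht
  have aux : ∀ Y : ℝ → E d, IsGradientFlow F x Y → ContinuousOn Y (Set.Icc 0 t) ∧
      ∀ s ∈ Set.Ico 0 t, HasDerivWithinAt Y (-gradient F (Y s)) (Set.Ici s) s := fun Y hY =>
    ⟨fun s hs => ((hY.2 s hs.1).continuousWithinAt).mono Set.Icc_subset_Ici_self,
      fun s hs => (hY.2 s hs.1).mono (Set.Ici_subset_Ici.mpr hs.1)⟩
  exact ODE_solution_unique (v := fun _ z => -gradient F z) (fun _ => hK)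
    (aux _ hX).1 (aux _ hX).2 (aux _ hG).1 (aux _ hG).2 (hX.1.trans hG.1.symm)
    (Set.right_mem_Icc.mpr ht)

end StochGradScheme

end

open StochGradScheme

namespace StochGradScheme

/-! ### Calculus -/

section Calculus

variable {V W : Type*} [NormedAddCommGroup V] [NormedSpace ℝ V]
  [NormedAddCommGroup W] [NormedSpace ℝ W]

/-! Compare both sides with the deterministic Euler iterates `x_n = T^n x₀`, where `T x = x - h
∇F(x)`. For small `h`, strong monotonicity makes `T` a contraction of factor `1 - hμ/2`, so a defect
of size `h²` per step accumulates to `O(h)` uniformly in time (`le_of_contracting_recursion`).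

Three errors are controlled in this way. The noise enters with factor `h`, is centered and is
independent of `X_n`; it therefore adds only `O(h²)` to the second moment, whence `E‖X_n - x_n‖² =
O(h)` (`integral_norm_scheme_sub_iterate_sq_le`). For the means the noise disappears and `T` is
affine up to `hM‖·‖²`, so the defect is `h · O(h)`, whence `‖E X_n - x_n‖ = O(h)`
(`norm_integral_scheme_sub_iterate_le`). The local Euler error is `O(h²)`, whence `x_n` is
`O(h)`-close to the flow (`norm_iterate_eulerStep_sub_gradientFlow_le`).

Finally, expand `φ` at `x_N`: the linear term sees only the error of the mean and the remainder only
the mean square, both `O(h)`. Second moments suffice throughout. -/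

theorem norm_fderiv_sub_le_of_norm_iteratedFDeriv_two_le {f : V → W} {M : ℝ}
    (hf : ContDiff ℝ 2 f) (hM : ∀ x, ‖iteratedFDeriv ℝ 2 f x‖ ≤ M) (x y : V) :
    ‖fderiv ℝ f y - fderiv ℝ f x‖ ≤ M * ‖y - x‖ := by
  have hd : Differentiable ℝ (fderiv ℝ f) :=
    (hf.fderiv_right (m := 1) (by norm_num)).differentiable (by norm_num)
  refine convex_univ.norm_image_sub_le_of_norm_fderiv_le (𝕜 := ℝ) (fun z _ => hd z)
    (fun z _ => ?_) (Set.mem_univ x) (Set.mem_univ y)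
  rw [← norm_iteratedFDeriv_one, norm_iteratedFDeriv_fderiv]
  exact hM z

theorem norm_taylor_one_le_of_norm_iteratedFDeriv_two_le {f : V → W} {M : ℝ}
    (hf : ContDiff ℝ 2 f) (hM : ∀ x, ‖iteratedFDeriv ℝ 2 f x‖ ≤ M) (x y : V) :
    ‖f y - f x - fderiv ℝ f x (y - x)‖ ≤ M * ‖y - x‖ ^ 2 := by
  have hM0 : 0 ≤ M := (norm_nonneg _).trans (hM x)
  have h := (convex_closedBall x ‖y - x‖).norm_image_sub_le_of_norm_fderiv_le' (𝕜 := ℝ)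
    (f := f) (φ := fderiv ℝ f x) (C := M * ‖y - x‖)
    (fun z _ => hf.differentiable (by norm_num) z)
    (fun z hz => (norm_fderiv_sub_le_of_norm_iteratedFDeriv_two_le hf hM x z).trans <| by
      rw [Metric.mem_closedBall, dist_eq_norm] at hz
      gcongr)
    (Metric.mem_closedBall_self (norm_nonneg _)) (y := y) (by simp [dist_eq_norm])
  rwa [mul_assoc, ← sq] at h

end Calculus

variable {d : ℕ}

/-! ### Operator norms, the seminorm `tripleNorm` and the Frobenius norm -/

theorem norm_gradient_eq_norm_fderiv (φ : E d → ℝ) (x : E d) :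
    ‖gradient φ x‖ = ‖fderiv ℝ φ x‖ := by
  rw [gradient, LinearIsometryEquiv.norm_map]

/-- A real supremum of an unbounded family is `0` by convention; `BoundedDeriv` supplies the upper
bound that makes the supremum meaningful. Directions with a zero entry, excluded from it, contribute
nothing by multilinearity. -/
theorem BoundedDeriv.norm_iteratedFDeriv_le_tripleNorm {m : ℕ} {φ : E d → ℝ}
    (hφ : BoundedDeriv m φ) (x : E d) : ‖iteratedFDeriv ℝ m φ x‖ ≤ tripleNorm m φ := by
  obtain ⟨M, hM⟩ := hφ
  have hle : ∀ p : E d × (Fin m → {k : E d // k ≠ 0}),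
      |iteratedFDeriv ℝ m φ p.1 (fun i => (p.2 i : E d))| / ∏ i, ‖(p.2 i : E d)‖ ≤ M := by
    intro p
    have hpos : 0 < ∏ i, ‖(p.2 i : E d)‖ :=
      Finset.prod_pos fun i _ => norm_pos_iff.mpr (p.2 i).2
    rw [div_le_iff₀ hpos]
    exact ((iteratedFDeriv ℝ m φ p.1).le_opNorm _).trans (by gcongr; exact hM _)
  have h0 : 0 ≤ tripleNorm m φ := Real.iSup_nonneg fun p => by positivity
  refine ContinuousMultilinearMap.opNorm_le_bound h0 fun k => ?_
  by_cases hk : ∃ i, k i = 0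
  · obtain ⟨i, hi⟩ := hk
    rw [(iteratedFDeriv ℝ m φ x).map_coord_zero i hi, norm_zero]
    positivity
  · push Not at hk
    have hpos : 0 < ∏ i, ‖k i‖ := Finset.prod_pos fun i _ => norm_pos_iff.mpr (hk i)
    rw [← div_le_iff₀ hpos]
    exact le_ciSup (f := fun p : E d × (Fin m → {k : E d // k ≠ 0}) =>
      |iteratedFDeriv ℝ m φ p.1 (fun i => (p.2 i : E d))| / ∏ i, ‖(p.2 i : E d)‖)
      ⟨M, Set.forall_mem_range.mpr hle⟩ (x, fun i => ⟨k i, hk i⟩)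

theorem norm_iteratedFDeriv_two_gradient (F : E d → ℝ) (x : E d) :
    ‖iteratedFDeriv ℝ 2 (gradient F) x‖ = ‖iteratedFDeriv ℝ 3 F x‖ := by
  have h := (InnerProductSpace.toDual ℝ (E d)).symm.norm_iteratedFDeriv_comp_left
    (fderiv ℝ F) x 2
  rw [norm_iteratedFDeriv_fderiv] at h
  exact h

theorem frobNorm_nonneg (M : Matrix (Fin d) (Fin d) ℝ) : 0 ≤ frobNorm M := Real.sqrt_nonneg _

theorem norm_toEuclideanCLM_le_frobNorm (M : Matrix (Fin d) (Fin d) ℝ) :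
    ‖Matrix.toEuclideanCLM (n := Fin d) (𝕜 := ℝ) M‖ ≤ frobNorm M := by
  refine ContinuousLinearMap.opNorm_le_bound _ (frobNorm_nonneg M) fun v => ?_
  rw [EuclideanSpace.norm_eq, EuclideanSpace.norm_eq v, frobNorm,
    ← Real.sqrt_mul (Finset.sum_nonneg fun i _ => Finset.sum_nonneg fun j _ => sq_nonneg _)]
  refine Real.sqrt_le_sqrt ?_
  rw [Finset.sum_mul]
  refine Finset.sum_le_sum fun i _ => ?_
  simp only [Matrix.ofLp_toEuclideanCLM, Matrix.mulVec, dotProduct, Real.norm_eq_abs, sq_abs]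
  exact Finset.sum_mul_sq_le_sq_mul_sq _ _ _

/-! ### The explicit Euler map of the gradient system -/

/-- One step of the explicit Euler method for the gradient system. -/
noncomputable def eulerStep (F : E d → ℝ) (h : ℝ) (x : E d) : E d := x - h • gradient F x

theorem eulerStep_minimizer {F : E d → ℝ} (hF : ObjectiveAssumption F) (h : ℝ) :
    eulerStep F h (minimizer F) = minimizer F := by
  rw [eulerStep, gradient_eq_zero_of_le (minimizer_le hF), smul_zero, sub_zero]

theorem contDiff_eulerStep {F : E d → ℝ} (hF : ObjectiveAssumption F) (h : ℝ) :
    ContDiff ℝ 2 (eulerStep F h) :=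
  contDiff_id.sub (hF.contDiff_gradient.const_smul h)

theorem norm_eulerStep_sub_le {F : E d → ℝ} {L μ h : ℝ}
    (hLip : ∀ x₁ x₂ : E d, ‖gradient F x₂ - gradient F x₁‖ ≤ L * ‖x₂ - x₁‖)
    (hconv : ∀ x₁ x₂ : E d,
      μ * ‖x₂ - x₁‖ ^ 2 ≤ inner ℝ (gradient F x₂ - gradient F x₁) (x₂ - x₁))
    (h0 : 0 ≤ h) (hL : h * L ^ 2 ≤ μ) (hμ : h * μ ≤ 1) (x y : E d) :
    ‖eulerStep F h x - eulerStep F h y‖ ≤ (1 - h * μ / 2) * ‖x - y‖ := by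
  have e : eulerStep F h x - eulerStep F h y
      = (x - y) - h • (gradient F x - gradient F y) := by
    simp only [eulerStep, smul_sub]; abel
  have h1 := hLip y x
  have h2 := mul_le_mul_of_nonneg_left (hconv y x) h0
  have h3 : ‖gradient F x - gradient F y‖ ^ 2 ≤ L ^ 2 * ‖x - y‖ ^ 2 := by
    rw [← mul_pow]; gcongr
  have h4 : h ^ 2 * ‖gradient F x - gradient F y‖ ^ 2 ≤ h * μ * ‖x - y‖ ^ 2 :=
    calc h ^ 2 * ‖gradient F x - gradient F y‖ ^ 2
        ≤ h ^ 2 * (L ^ 2 * ‖x - y‖ ^ 2) := by gcongr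
      _ = h * (h * L ^ 2) * ‖x - y‖ ^ 2 := by ring
      _ ≤ h * μ * ‖x - y‖ ^ 2 := by gcongr
  -- Expanding the square gives the factor `1 - 2hμ + h²L² ≤ 1 - hμ ≤ (1 - hμ/2)²`.
  refine abs_le_of_sq_le_sq' ?_ (by nlinarith [norm_nonneg (x - y)]) |>.2
  rw [e, norm_sub_sq_real, inner_smul_right, norm_smul, mul_pow, Real.norm_eq_abs, sq_abs,
    real_inner_comm]
  nlinarith [sq_nonneg (h * μ * ‖x - y‖)]

/-- Passes the contraction factor on to the linear part of the step, which drives the recursion for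
the means. -/
theorem norm_fderiv_eulerStep_le {F : E d → ℝ} {h ρ : ℝ} (hρ : 0 ≤ ρ)
    (hT : ∀ x y, ‖eulerStep F h x - eulerStep F h y‖ ≤ ρ * ‖x - y‖) (x : E d) :
    ‖fderiv ℝ (eulerStep F h) x‖ ≤ ρ := by
  have hl : LipschitzWith ⟨ρ, hρ⟩ (eulerStep F h) := LipschitzWith.of_dist_le_mul fun x y => by
    rw [dist_eq_norm, dist_eq_norm]; exact hT x y
  exact norm_fderiv_le_of_lipschitz ℝ hl

theorem norm_taylor_eulerStep_le {F : E d → ℝ} (hF : ObjectiveAssumption F) {M h : ℝ}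
    (hM : ∀ x, ‖iteratedFDeriv ℝ 3 F x‖ ≤ M) (h0 : 0 ≤ h) (x y : E d) :
    ‖eulerStep F h y - eulerStep F h x - fderiv ℝ (eulerStep F h) x (y - x)‖
      ≤ h * M * ‖y - x‖ ^ 2 := by
  have hd : DifferentiableAt ℝ (gradient F) x :=
    hF.contDiff_gradient.differentiable (by norm_num) x
  have hfd : HasFDerivAt (eulerStep F h)
      (ContinuousLinearMap.id ℝ (E d) - h • fderiv ℝ (gradient F) x) x :=
    (hasFDerivAt_id x).sub (hd.hasFDerivAt.const_smul h)
  have e : eulerStep F h y - eulerStep F h x - fderiv ℝ (eulerStep F h) x (y - x)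
      = -(h • (gradient F y - gradient F x - fderiv ℝ (gradient F) x (y - x))) := by
    rw [hfd.fderiv]
    simp only [eulerStep, smul_sub, sub_apply, ContinuousLinearMap.id_apply,
      smul_apply]
    abel
  rw [e, norm_neg, norm_smul, Real.norm_of_nonneg h0, mul_assoc]
  gcongr
  exact norm_taylor_one_le_of_norm_iteratedFDeriv_two_le hF.contDiff_gradient
    (fun z => (norm_iteratedFDeriv_two_gradient F z).trans_le (hM z)) x y

theorem norm_iterate_sub_le {T : E d → E d} {ρ : ℝ} (hρ : ρ ≤ 1)
    (hT : ∀ x y, ‖T x - T y‖ ≤ ρ * ‖x - y‖) {z : E d} (hz : T z = z) (x : E d) (n : ℕ) :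
    ‖T^[n] x - z‖ ≤ ‖x - z‖ := by
  induction n with
  | zero => simp
  | succ n ih =>
    rw [Function.iterate_succ_apply']
    have h1 := hT (T^[n] x) z
    rw [hz] at h1
    exact (h1.trans (mul_le_of_le_one_left (norm_nonneg _) hρ)).trans ih

/-- `K` is a fixed point of `t ↦ (1 - c) t + c K`, which is monotone. With `c` proportional to `h`,
a defect `h²` gives `K` of order `h`, independent of `n`. -/
theorem le_of_contracting_recursion {a : ℕ → ℝ} {c K : ℝ} (hc : c ≤ 1) (h0 : a 0 ≤ K)
    (hstep : ∀ n, a (n + 1) ≤ (1 - c) * a n + c * K) (n : ℕ) : a n ≤ K := by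
  induction n with
  | zero => exact h0
  | succ n ih =>
    have := mul_le_mul_of_nonneg_left ih (sub_nonneg.mpr hc)
    linarith [hstep n]

/-! ### The gradient flow -/

theorem IsGradientFlow.hasDerivAt {F : E d → ℝ} {x : E d} {X : ℝ → E d}
    (hX : IsGradientFlow F x X) {t : ℝ} (ht : 0 < t) : HasDerivAt X (-gradient F (X t)) t :=
  (hX.2 t ht.le).hasDerivAt (Ici_mem_nhds ht)

/-- The squared distance to the minimizer has derivative `-2⟨X - x⋆, ∇F(X)⟩ ≤ 0`, since `∇F(x⋆) =
0`. At time `0`, continuity is enough. -/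
theorem IsGradientFlow.norm_sub_minimizer_le {F : E d → ℝ} (hF : ObjectiveAssumption F)
    {x : E d} {X : ℝ → E d} (hX : IsGradientFlow F x X) {t : ℝ} (ht : 0 ≤ t) :
    ‖X t - minimizer F‖ ≤ ‖x - minimizer F‖ := by
  obtain ⟨μ, hμ, hconv⟩ := hF.mu_convex
  have hder : ∀ s, 0 < s → HasDerivAt (fun s => ‖X s - minimizer F‖ ^ 2)
      (2 * inner ℝ (X s - minimizer F) (-gradient F (X s))) s := fun s hs =>
    ((hX.hasDerivAt hs).sub_const (minimizer F)).norm_sq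
  have hanti : AntitoneOn (fun s => ‖X s - minimizer F‖ ^ 2) (Set.Ici 0) := by
    refine antitoneOn_of_deriv_nonpos (convex_Ici 0) ?_ ?_ ?_
    · intro s hs
      exact (((hX.2 s hs).continuousWithinAt.sub continuousWithinAt_const).norm.pow 2)
    · intro s hs
      rw [interior_Ici] at hs
      exact (hder s hs).differentiableAt.differentiableWithinAt
    · intro s hs
      rw [interior_Ici] at hs
      rw [(hder s hs).deriv, inner_neg_right, real_inner_comm]
      have h1 := hconv (minimizer F) (X s)
      rw [gradient_eq_zero_of_le (minimizer_le hF), sub_zero] at h1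
      have : 0 ≤ μ * ‖X s - minimizer F‖ ^ 2 := by positivity
      linarith
  have h2 := hanti (Set.mem_Ici.mpr le_rfl) ht ht
  simp only [hX.1] at h2
  exact (pow_le_pow_iff_left₀ (norm_nonneg _) (norm_nonneg _) two_ne_zero).mp h2

/-- The speed is at most `L r` along the whole trajectory, so during one step the point moves by at
most `L r h` and the gradient by at most `L² r h`; integrating over the step gives a second factor
`h`. -/
theorem IsGradientFlow.norm_sub_eulerStep_le {F : E d → ℝ} (hF : ObjectiveAssumption F) {L : ℝ}
    (hL : 0 ≤ L) (hLip : ∀ x₁ x₂ : E d, ‖gradient F x₂ - gradient F x₁‖ ≤ L * ‖x₂ - x₁‖)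
    {x : E d} {X : ℝ → E d} (hX : IsGradientFlow F x X) {t h : ℝ} (ht : 0 ≤ t) (hh : 0 ≤ h) :
    ‖X (t + h) - eulerStep F h (X t)‖ ≤ L ^ 2 * ‖x - minimizer F‖ * h ^ 2 := by
  set r := ‖x - minimizer F‖ with hr
  have hder : ∀ s ∈ Set.Icc t (t + h),
      HasDerivWithinAt X (-gradient F (X s)) (Set.Icc t (t + h)) s := fun s hs =>
    (hX.2 s (ht.trans hs.1)).mono fun u hu => ht.trans hu.1
  have hg : ∀ s, 0 ≤ s → ‖gradient F (X s)‖ ≤ L * r := by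
    intro s hs
    have h1 := hLip (minimizer F) (X s)
    rw [gradient_eq_zero_of_le (minimizer_le hF), sub_zero] at h1
    exact h1.trans (by gcongr; exact hX.norm_sub_minimizer_le hF hs)
  have hinc : ∀ s ∈ Set.Icc t (t + h), ‖X s - X t‖ ≤ L * r * h := by
    intro s hs
    refine (norm_image_sub_le_of_norm_deriv_le_segment' hder
      (fun u hu => (norm_neg _).trans_le (hg u (ht.trans hu.1))) s hs).trans ?_
    gcongr
    linarith [hs.2]
  -- This auxiliary curve has derivative `∇F(X t) - ∇F(X s)`, and its increment over the step is the
  -- local error.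
  have hrem := norm_image_sub_le_of_norm_deriv_le_segment'
    (f := fun s => X s + s • gradient F (X t)) (C := L ^ 2 * r * h)
    (fun s hs => (hder s hs).add ((hasDerivWithinAt_id s _).smul_const (gradient F (X t))))
    (fun s hs => by
      have h1 := (hLip (X s) (X t)).trans
        (mul_le_mul_of_nonneg_left (norm_sub_rev (X s) (X t) ▸ hinc s ⟨hs.1, hs.2.le⟩) hL)
      rw [one_smul, neg_add_eq_sub]
      exact h1.trans_eq (by ring))
    (t + h) (Set.right_mem_Icc.mpr (by linarith))
  have e : X (t + h) - eulerStep F h (X t)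
      = X (t + h) + (t + h) • gradient F (X t) - (X t + t • gradient F (X t)) := by
    rw [eulerStep, add_smul]; abel
  rw [e]
  exact hrem.trans_eq (by ring)

theorem norm_iterate_eulerStep_sub_gradientFlow_le {F : E d → ℝ} (hF : ObjectiveAssumption F)
    {L μ h : ℝ} (hL : 0 ≤ L) (hμ : 0 < μ) (hh : 0 < h) (hhμ : h * μ ≤ 1)
    (hLip : ∀ x₁ x₂ : E d, ‖gradient F x₂ - gradient F x₁‖ ≤ L * ‖x₂ - x₁‖)
    (hT : ∀ x y, ‖eulerStep F h x - eulerStep F h y‖ ≤ (1 - h * μ / 2) * ‖x - y‖)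
    (x : E d) (n : ℕ) :
    ‖(eulerStep F h)^[n] x - gradientFlow F x (n * h)‖
      ≤ 2 * L ^ 2 / μ * ‖x - minimizer F‖ * h := by
  have hX := isGradientFlow_gradientFlow hF x
  refine le_of_contracting_recursion (c := h * μ / 2) (a := fun n : ℕ =>
    ‖(eulerStep F h)^[n] x - gradientFlow F x (n * h)‖) (by linarith) ?_ (fun n => ?_) n
  · simp only [Function.iterate_zero, id, Nat.cast_zero, zero_mul, hX.1, sub_self, norm_zero]
    positivity
  · have h1 := hX.norm_sub_eulerStep_le hF hL hLip (t := n * h) (by positivity) hh.le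
    have h2 := hT ((eulerStep F h)^[n] x) (gradientFlow F x (n * h))
    have h3 := norm_sub_le_norm_sub_add_norm_sub ((eulerStep F h)^[n + 1] x)
      (eulerStep F h (gradientFlow F x (n * h))) (gradientFlow F x (n * h + h))
    rw [norm_sub_rev (eulerStep F h (gradientFlow F x (n * h)))] at h3
    rw [Function.iterate_succ_apply'] at h3 ⊢
    have e : ((n + 1 : ℕ) : ℝ) * h = n * h + h := by push_cast; ring
    rw [e]
    have e2 : h * μ / 2 * (2 * L ^ 2 / μ * ‖x - minimizer F‖ * h)
        = L ^ 2 * ‖x - minimizer F‖ * h ^ 2 := by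
      field_simp
    linarith

/-! ### One stochastic step -/

section Step

variable {Ω : Type*} {X γ : Ω → E d} {A : E d → E d →L[ℝ] E d} {B : ℝ} {z : E d}

theorem norm_apply_sq_le (hAB : ∀ x, ‖A x‖ ≤ B * (1 + ‖x - z‖)) (ω : Ω) :
    ‖A (X ω) (γ ω)‖ ^ 2 ≤ B ^ 2 * ((1 + ‖X ω - z‖) ^ 2 * ‖γ ω‖ ^ 2) := by
  rw [← mul_assoc, ← mul_pow, ← mul_pow]
  gcongr
  exact ((A (X ω)).le_opNorm _).trans (by gcongr; exact hAB _)

variable [MeasurableSpace Ω] {P : Measure Ω}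

theorem memLp_two_of_hasLaw_stdGaussian (hγ : HasLaw γ (stdGaussian (E d)) P) : MemLp γ 2 P := by
  have h : MemLp id 2 (P.map γ) := by
    rw [hγ.map_eq]; exact IsGaussian.memLp_two_id
  exact h.comp_of_map hγ.aemeasurable

theorem integral_eq_zero_of_hasLaw_stdGaussian (hγ : HasLaw γ (stdGaussian (E d)) P) :
    ∫ ω, γ ω ∂P = 0 := by
  rw [hγ.integral_eq, integral_id_stdGaussian]

theorem aestronglyMeasurable_apply (hA : Continuous A) (hX : MemLp X 2 P)
    (hγ : HasLaw γ (stdGaussian (E d)) P) :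
    AEStronglyMeasurable (fun ω => A (X ω) (γ ω)) P :=
  Continuous.comp_aestronglyMeasurable₂ (g := fun x v => A x v)
    ((hA.comp continuous_fst).clm_apply continuous_snd) hX.1
    hγ.aemeasurable.aestronglyMeasurable

variable [IsProbabilityMeasure P]

theorem memLp_two_comp_of_norm_sub_le {T : E d → E d} {ρ : ℝ} (hTc : Continuous T)
    (hT : ∀ x y, ‖T x - T y‖ ≤ ρ * ‖x - y‖) (hX : MemLp X 2 P) :
    MemLp (fun ω => T (X ω)) 2 P := by
  have h1 : MemLp (fun ω => T (X ω) - T 0) 2 P :=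
    hX.of_le_mul (c := ρ) ((hTc.comp_aestronglyMeasurable hX.1).sub aestronglyMeasurable_const)
      (Filter.Eventually.of_forall fun ω => by simpa using hT (X ω) 0)
  exact (memLp_congr_ae (Filter.Eventually.of_forall fun ω => by simp)).mp
    (h1.add (memLp_const (T 0)))

theorem integrable_one_add_norm_sub_sq (hX : MemLp X 2 P) (z : E d) :
    Integrable (fun ω => (1 + ‖X ω - z‖) ^ 2) P :=
  ((memLp_const (1 : ℝ)).add (hX.sub (memLp_const z)).norm).integrable_sq

theorem integral_one_add_norm_sub_sq_le (hX : MemLp X 2 P) (z : E d) :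
    ∫ ω, (1 + ‖X ω - z‖) ^ 2 ∂P ≤ 2 * (1 + ∫ ω, ‖X ω - z‖ ^ 2 ∂P) := by
  have hi : Integrable (fun ω => ‖X ω - z‖ ^ 2) P := (hX.sub (memLp_const z)).norm.integrable_sq
  have h1 : ∫ ω, 2 * (1 + ‖X ω - z‖ ^ 2) ∂P = 2 * (1 + ∫ ω, ‖X ω - z‖ ^ 2 ∂P) := by
    rw [integral_const_mul, integral_add (integrable_const _) hi]
    simp
  rw [← h1]
  refine integral_mono (integrable_one_add_norm_sub_sq hX z)
    (((integrable_const _).add hi).const_mul 2) fun ω => ?_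
  have := sq_nonneg (1 - ‖X ω - z‖)
  simp only
  linarith

theorem integrable_growth_mul_norm_sq (hX : MemLp X 2 P) (hγ : HasLaw γ (stdGaussian (E d)) P)
    (hind : IndepFun X γ P) (z : E d) :
    Integrable (fun ω => (1 + ‖X ω - z‖) ^ 2 * ‖γ ω‖ ^ 2) P := by
  have hi : IndepFun (fun ω => (1 + ‖X ω - z‖) ^ 2) (fun ω => ‖γ ω‖ ^ 2) P :=
    hind.comp (φ := fun x => (1 + ‖x - z‖) ^ 2) (ψ := fun v => ‖v‖ ^ 2) (by fun_prop)
      (by fun_prop)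
  exact hi.integrable_mul (integrable_one_add_norm_sub_sq hX z)
    (memLp_two_of_hasLaw_stdGaussian hγ).norm.integrable_sq

theorem memLp_two_apply (hA : Continuous A) (hAB : ∀ x, ‖A x‖ ≤ B * (1 + ‖x - z‖))
    (hX : MemLp X 2 P) (hγ : HasLaw γ (stdGaussian (E d)) P) (hind : IndepFun X γ P) :
    MemLp (fun ω => A (X ω) (γ ω)) 2 P := by
  have hm := aestronglyMeasurable_apply hA hX hγ
  rw [memLp_two_iff_integrable_sq_norm hm]
  refine ((integrable_growth_mul_norm_sq hX hγ hind z).const_mul (B ^ 2)).mono' (hm.norm.pow 2)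
    (Filter.Eventually.of_forall fun ω => ?_)
  rw [Real.norm_of_nonneg (by positivity)]
  exact norm_apply_sq_le hAB ω

theorem integral_norm_apply_sq_le (hA : Continuous A) (hAB : ∀ x, ‖A x‖ ≤ B * (1 + ‖x - z‖))
    (hX : MemLp X 2 P) (hγ : HasLaw γ (stdGaussian (E d)) P) (hind : IndepFun X γ P) :
    ∫ ω, ‖A (X ω) (γ ω)‖ ^ 2 ∂P
      ≤ 2 * B ^ 2 * (∫ v, ‖v‖ ^ 2 ∂stdGaussian (E d)) * (1 + ∫ ω, ‖X ω - z‖ ^ 2 ∂P) := by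
  have hi : IndepFun (fun ω => (1 + ‖X ω - z‖) ^ 2) (fun ω => ‖γ ω‖ ^ 2) P :=
    hind.comp (φ := fun x => (1 + ‖x - z‖) ^ 2) (ψ := fun v => ‖v‖ ^ 2) (by fun_prop)
      (by fun_prop)
  have hκ : ∫ ω, ‖γ ω‖ ^ 2 ∂P = ∫ v, ‖v‖ ^ 2 ∂stdGaussian (E d) :=
    hγ.integral_comp (f := fun v => ‖v‖ ^ 2) (by fun_prop)
  have hκ0 : 0 ≤ ∫ v, ‖v‖ ^ 2 ∂stdGaussian (E d) := integral_nonneg fun v => by positivity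
  calc ∫ ω, ‖A (X ω) (γ ω)‖ ^ 2 ∂P
      ≤ ∫ ω, B ^ 2 * ((1 + ‖X ω - z‖) ^ 2 * ‖γ ω‖ ^ 2) ∂P :=
        integral_mono (memLp_two_apply hA hAB hX hγ hind).norm.integrable_sq
          ((integrable_growth_mul_norm_sq hX hγ hind z).const_mul _) (norm_apply_sq_le hAB)
    _ = B ^ 2 * ((∫ ω, (1 + ‖X ω - z‖) ^ 2 ∂P) * ∫ v, ‖v‖ ^ 2 ∂stdGaussian (E d)) := by
        rw [integral_const_mul, hi.integral_fun_mul_eq_mul_integral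
          (integrable_one_add_norm_sub_sq hX z).1
          (memLp_two_of_hasLaw_stdGaussian hγ).norm.integrable_sq.1, hκ]
    _ ≤ B ^ 2 * (2 * (1 + ∫ ω, ‖X ω - z‖ ^ 2 ∂P) * ∫ v, ‖v‖ ^ 2 ∂stdGaussian (E d)) := by
        gcongr
        exact integral_one_add_norm_sub_sq_le hX z
    _ = _ := by ring

theorem memLp_two_coefficient (hA : Continuous A) (hAB : ∀ x, ‖A x‖ ≤ B * (1 + ‖x - z‖))
    (hX : MemLp X 2 P) : MemLp (fun ω => A (X ω)) 2 P := by
  have h : MemLp (fun ω => 1 + ‖X ω - z‖) 2 P :=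
    (memLp_const (1 : ℝ)).add (hX.sub (memLp_const z)).norm
  refine h.of_le_mul (c := B) (hA.comp_aestronglyMeasurable hX.1)
    (Filter.Eventually.of_forall fun ω => ?_)
  rw [Real.norm_of_nonneg (by positivity)]
  exact hAB _

theorem integral_apply_eq_zero (hA : Continuous A) (hAB : ∀ x, ‖A x‖ ≤ B * (1 + ‖x - z‖))
    (hX : MemLp X 2 P) (hγ : HasLaw γ (stdGaussian (E d)) P) (hind : IndepFun X γ P) :
    ∫ ω, A (X ω) (γ ω) ∂P = 0 := by
  have hi : IndepFun (fun ω => A (X ω)) γ P :=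
    hind.comp (φ := A) (ψ := id) hA.measurable measurable_id
  -- The bilinear map is evaluation `(A, v) ↦ A v`, encoded as the identity on operators; the
  -- expectation factorizes and `γ` has mean zero.
  have h := hi.integral_bilin ((memLp_two_coefficient hA hAB hX).integrable one_le_two)
    ((memLp_two_of_hasLaw_stdGaussian hγ).integrable one_le_two)
    (ContinuousLinearMap.id ℝ (E d →L[ℝ] E d))
  rw [integral_eq_zero_of_hasLaw_stdGaussian hγ, map_zero] at h
  exact h

/-- Moving `A` to the other side by the adjoint leaves the pairing of a function of `X` alone with
the independent centered vector `γ`. -/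
theorem integral_inner_apply_eq_zero (hA : Continuous A)
    (hAB : ∀ x, ‖A x‖ ≤ B * (1 + ‖x - z‖)) (hX : MemLp X 2 P)
    (hγ : HasLaw γ (stdGaussian (E d)) P) (hind : IndepFun X γ P)
    {u : E d → E d} (hu : Continuous u) (huX : MemLp (fun ω => u (X ω)) 2 P) :
    ∫ ω, inner ℝ (u (X ω)) (A (X ω) (γ ω)) ∂P = 0 := by
  set V : E d → E d := fun x => ContinuousLinearMap.adjoint (A x) (u x) with hVdef
  have hV : Continuous V :=
    (ContinuousLinearMap.adjoint.continuous.comp hA).clm_apply hu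
  have hVi : Integrable (fun ω => V (X ω)) P := by
    refine ((memLp_two_coefficient hA hAB hX).norm.integrable_mul huX.norm).mono'
      (hV.comp_aestronglyMeasurable hX.1) (Filter.Eventually.of_forall fun ω => ?_)
    refine ((ContinuousLinearMap.adjoint (A (X ω))).le_opNorm _).trans_eq ?_
    rw [LinearIsometryEquiv.norm_map]
    rfl
  have hi : IndepFun (fun ω => V (X ω)) γ P :=
    hind.comp (φ := V) (ψ := id) hV.measurable measurable_id
  have h := hi.integral_bilin hVi
    ((memLp_two_of_hasLaw_stdGaussian hγ).integrable one_le_two) (innerSL ℝ)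
  rw [integral_eq_zero_of_hasLaw_stdGaussian hγ, map_zero] at h
  refine (integral_congr_ae (Filter.Eventually.of_forall fun ω => ?_)).trans h
  exact (ContinuousLinearMap.adjoint_inner_left (A (X ω)) (γ ω) (u (X ω))).symm

theorem integral_norm_add_smul_apply_sq (hA : Continuous A)
    (hAB : ∀ x, ‖A x‖ ≤ B * (1 + ‖x - z‖)) (hX : MemLp X 2 P)
    (hγ : HasLaw γ (stdGaussian (E d)) P) (hind : IndepFun X γ P)
    {u : E d → E d} (hu : Continuous u) (huX : MemLp (fun ω => u (X ω)) 2 P) (h : ℝ) :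
    ∫ ω, ‖u (X ω) + h • A (X ω) (γ ω)‖ ^ 2 ∂P
      = ∫ ω, ‖u (X ω)‖ ^ 2 ∂P + h ^ 2 * ∫ ω, ‖A (X ω) (γ ω)‖ ^ 2 ∂P := by
  have hW := memLp_two_apply hA hAB hX hγ hind
  have hin : Integrable (fun ω => inner ℝ (u (X ω)) (A (X ω) (γ ω))) P := by
    refine (huX.norm.integrable_mul hW.norm).mono' (huX.1.inner hW.1)
      (Filter.Eventually.of_forall fun ω => ?_)
    exact norm_inner_le_norm _ _
  have e : ∀ ω, ‖u (X ω) + h • A (X ω) (γ ω)‖ ^ 2 = ‖u (X ω)‖ ^ 2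
      + (2 * h) * inner ℝ (u (X ω)) (A (X ω) (γ ω)) + h ^ 2 * ‖A (X ω) (γ ω)‖ ^ 2 := fun ω => by
    rw [norm_add_sq_real, inner_smul_right, norm_smul, mul_pow, Real.norm_eq_abs, sq_abs]
    ring
  simp_rw [e]
  rw [integral_add (f := fun ω => ‖u (X ω)‖ ^ 2
      + (2 * h) * inner ℝ (u (X ω)) (A (X ω) (γ ω)))
    (huX.norm.integrable_sq.add (hin.const_mul _))
    (hW.norm.integrable_sq.const_mul _), integral_add huX.norm.integrable_sq (hin.const_mul _),
    integral_const_mul, integral_const_mul,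
    integral_inner_apply_eq_zero hA hAB hX hγ hind hu huX, mul_zero, add_zero]

/-- The cross term vanishes, so the noise costs only `h²`. The point `y` is kept apart from the
growth center `z` because the bound serves both at the minimizer and along the Euler iterates. The
factor `ρ²` is relaxed to `ρ`, which is enough for the recursions. -/
theorem integral_norm_step_sub_sq_le (hA : Continuous A)
    (hAB : ∀ x, ‖A x‖ ≤ B * (1 + ‖x - z‖)) (hX : MemLp X 2 P)
    (hγ : HasLaw γ (stdGaussian (E d)) P) (hind : IndepFun X γ P)
    {T : E d → E d} (hTc : Continuous T) {ρ : ℝ} (hρ0 : 0 ≤ ρ) (hρ1 : ρ ≤ 1)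
    (hT : ∀ x y, ‖T x - T y‖ ≤ ρ * ‖x - y‖) (h : ℝ) (y : E d) :
    ∫ ω, ‖T (X ω) + h • A (X ω) (γ ω) - T y‖ ^ 2 ∂P
      ≤ ρ * ∫ ω, ‖X ω - y‖ ^ 2 ∂P
        + h ^ 2 * (2 * B ^ 2 * (∫ v, ‖v‖ ^ 2 ∂stdGaussian (E d))
          * (1 + ∫ ω, ‖X ω - z‖ ^ 2 ∂P)) := by
  have huX : MemLp (fun ω => T (X ω) - T y) 2 P :=
    (memLp_two_comp_of_norm_sub_le hTc hT hX).sub (memLp_const (T y))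
  have h1 := integral_norm_add_smul_apply_sq hA hAB hX hγ hind (u := fun x => T x - T y)
    (hTc.sub continuous_const) huX h
  have e : ∀ ω, T (X ω) + h • A (X ω) (γ ω) - T y = T (X ω) - T y + h • A (X ω) (γ ω) :=
    fun ω => by abel
  simp_rw [e]
  rw [h1, ← integral_const_mul ρ]
  refine add_le_add (integral_mono huX.norm.integrable_sq
    ((hX.sub (memLp_const y)).norm.integrable_sq.const_mul ρ) fun ω => ?_)
    (mul_le_mul_of_nonneg_left (integral_norm_apply_sq_le hA hAB hX hγ hind) (sq_nonneg h))
  calc ‖T (X ω) - T y‖ ^ 2 ≤ (ρ * ‖X ω - y‖) ^ 2 := by gcongr; exact hT _ _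
    _ = (ρ * ρ) * ‖X ω - y‖ ^ 2 := by ring
    _ ≤ ρ * ‖X ω - y‖ ^ 2 := by gcongr; exact mul_le_of_le_one_left hρ0 hρ1

end Step

/-! ### The scheme -/

section Scheme

variable {Ω : Type*} {F : E d → ℝ} {σ : ℝ → E d → Matrix (Fin d) (Fin d) ℝ} {h : ℝ} {x₀ : E d}
  {γ : ℕ → Ω → E d}

/-- The diffusion coefficient as an operator on the Euclidean space. -/
noncomputable def diffusionCLM (σ : ℝ → E d → Matrix (Fin d) (Fin d) ℝ) (t : ℝ) (x : E d) :
    E d →L[ℝ] E d :=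
  Matrix.toEuclideanCLM (n := Fin d) (𝕜 := ℝ) (σ t x)

theorem DiffusionAssumption.continuous_diffusionCLM (hσ : DiffusionAssumption F σ) {t : ℝ}
    (ht : 0 ≤ t) : Continuous (diffusionCLM σ t) := by
  have h1 : Continuous (σ t) := hσ.continuousOn.comp_continuous
    (f := fun x : E d => (t, x)) (by fun_prop) fun x => ⟨ht, Set.mem_univ x⟩
  have h2 : Continuous (Matrix.toEuclideanCLM (n := Fin d) (𝕜 := ℝ)) :=
    LinearMap.continuous_of_finiteDimensional
      (Matrix.toEuclideanCLM (n := Fin d) (𝕜 := ℝ)).toAlgEquiv.toLinearMap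
  exact h2.comp h1

theorem DiffusionAssumption.exists_norm_diffusionCLM_le (hσ : DiffusionAssumption F σ) :
    ∃ B : ℝ, ∀ t, 0 ≤ t → ∀ x, ‖diffusionCLM σ t x‖ ≤ B * (1 + ‖x - minimizer F‖) := by
  obtain ⟨ς, -, -, hg, B, hB⟩ := hσ.lipschitz_growth
  refine ⟨B, fun t ht x => (norm_toEuclideanCLM_le_frobNorm _).trans ?_⟩
  rw [← div_le_iff₀ (by positivity)]
  exact (hg t ht x).trans (hB ⟨t, ht, rfl⟩)

theorem scheme_succ (n : ℕ) (ω : Ω) : scheme F σ h x₀ γ (n + 1) ω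
    = eulerStep F h (scheme F σ h x₀ γ n ω)
      + h • diffusionCLM σ (n * h) (scheme F σ h x₀ γ n ω) (γ n ω) := rfl

/-- With `γ` indexed from zero, `X_n` depends on `γ 0, …, γ (n - 1)` only, hence is independent of
the next vector `γ n`. -/
theorem measurable_scheme_iSup_comap (hF : ObjectiveAssumption F) (hσ : DiffusionAssumption F σ)
    (hh : 0 ≤ h) (n : ℕ) :
    Measurable[⨆ i ∈ Set.Iio n, MeasurableSpace.comap (γ i) inferInstance]
      (scheme F σ h x₀ γ n) := by
  induction n with
  | zero => exact measurable_const
  | succ n ih =>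
    have hle : (⨆ i ∈ Set.Iio n, MeasurableSpace.comap (γ i) inferInstance)
        ≤ ⨆ i ∈ Set.Iio (n + 1), MeasurableSpace.comap (γ i) inferInstance :=
      biSup_mono fun i hi => hi.trans n.lt_succ_self
    have hX := ih.mono hle le_rfl
    have hγ : Measurable[⨆ i ∈ Set.Iio (n + 1), MeasurableSpace.comap (γ i) inferInstance] (γ n) :=
      (comap_measurable (γ n)).mono (le_biSup (fun i => MeasurableSpace.comap (γ i) inferInstance)
        (Set.mem_Iio.mpr n.lt_succ_self)) le_rfl
    have hc : Continuous fun p : E d × E d =>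
        eulerStep F h p.1 + h • diffusionCLM σ (n * h) p.1 p.2 :=
      ((contDiff_eulerStep hF h).continuous.comp continuous_fst).add
        ((((hσ.continuous_diffusionCLM (by positivity)).comp continuous_fst).clm_apply
          continuous_snd).const_smul h)
    exact hc.measurable.comp (hX.prodMk hγ)

variable [MeasurableSpace Ω] {P : Measure Ω}

theorem indepFun_scheme (hF : ObjectiveAssumption F) (hσ : DiffusionAssumption F σ)
    (hh : 0 ≤ h) (hγm : ∀ n, Measurable (γ n)) (hind : iIndepFun γ P) (n : ℕ) :
    IndepFun (scheme F σ h x₀ γ n) (γ n) P := by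
  have h1 := indep_iSup_of_disjoint (fun i => (hγm i).comap_le) hind
    (S := Set.Iio n) (T := {n}) (by simp)
  rw [iSup_singleton] at h1
  exact indep_of_indep_of_le_left h1 (measurable_scheme_iSup_comap hF hσ hh n).comap_le

variable [IsProbabilityMeasure P]

theorem memLp_two_scheme (hF : ObjectiveAssumption F) (hσ : DiffusionAssumption F σ)
    (hh : 0 ≤ h) (hγm : ∀ n, Measurable (γ n))
    (hγ : ∀ n, HasLaw (γ n) (stdGaussian (E d)) P) (hind : iIndepFun γ P)
    {ρ : ℝ} (hT : ∀ x y, ‖eulerStep F h x - eulerStep F h y‖ ≤ ρ * ‖x - y‖) (n : ℕ) :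
    MemLp (scheme F σ h x₀ γ n) 2 P := by
  obtain ⟨B, hB⟩ := hσ.exists_norm_diffusionCLM_le
  induction n with
  | zero => exact memLp_const x₀
  | succ n ih =>
    have ht : (0 : ℝ) ≤ n * h := by positivity
    exact (memLp_two_comp_of_norm_sub_le (contDiff_eulerStep hF h).continuous hT ih).add
      ((memLp_two_apply (hσ.continuous_diffusionCLM ht) (hB _ ht) ih (hγ n)
        (indepFun_scheme hF hσ hh hγm hind n)).const_smul h)

end Scheme

/-! ### Weak error estimates -/

section Taylor

variable {Ω : Type*} [MeasurableSpace Ω] {P : Measure Ω} [IsProbabilityMeasure P]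
  {W : Type*} [NormedAddCommGroup W] [NormedSpace ℝ W]
  {X : Ω → E d} {f : E d → W} {y : E d} {D : E d →L[ℝ] W} {M : ℝ}

theorem integrable_taylor_remainder (hf : Continuous f)
    (hrem : ∀ x, ‖f x - f y - D (x - y)‖ ≤ M * ‖x - y‖ ^ 2) (hX : MemLp X 2 P) :
    Integrable (fun ω => f (X ω) - f y - D (X ω - y)) P := by
  have hc : Continuous fun x => f x - f y - D (x - y) := by fun_prop
  exact ((hX.sub (memLp_const y)).norm.integrable_sq.const_mul M).mono'
    (hc.comp_aestronglyMeasurable hX.1) (Filter.Eventually.of_forall fun ω => hrem (X ω))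

theorem integrable_comp_of_taylor (hf : Continuous f)
    (hrem : ∀ x, ‖f x - f y - D (x - y)‖ ≤ M * ‖x - y‖ ^ 2) (hX : MemLp X 2 P) :
    Integrable (fun ω => f (X ω)) P := by
  have h1 := (((integrable_taylor_remainder hf hrem hX).add (D.integrable_comp
    ((hX.integrable one_le_two).sub (integrable_const y)))).add (integrable_const (f y)))
  exact h1.congr (Filter.Eventually.of_forall fun ω => by simp)

/-- The linear term commutes with the expectation, so it feels only the bias of `X`, not its
fluctuations. Applied to `eulerStep F h` for the means and to `φ` at the end. -/
theorem norm_integral_comp_sub_le_of_taylor [CompleteSpace W] (hf : Continuous f)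
    (hrem : ∀ x, ‖f x - f y - D (x - y)‖ ≤ M * ‖x - y‖ ^ 2) (hX : MemLp X 2 P) :
    ‖∫ ω, f (X ω) ∂P - f y‖ ≤ ‖D (∫ ω, X ω ∂P - y)‖ + M * ∫ ω, ‖X ω - y‖ ^ 2 ∂P := by
  have hXi := hX.integrable one_le_two
  have hXy : Integrable (fun ω => X ω - y) P := hXi.sub (integrable_const y)
  have e : ∫ ω, f (X ω) ∂P - f y
      = D (∫ ω, X ω ∂P - y) + ∫ ω, (f (X ω) - f y - D (X ω - y)) ∂P := by
    have hfi := integrable_comp_of_taylor hf hrem hX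
    have h1 : ∫ ω, (X ω - y) ∂P = ∫ ω, X ω ∂P - y := by
      rw [integral_sub hXi (integrable_const y)]; simp
    have h2 : ∫ ω, (f (X ω) - f y) ∂P = ∫ ω, f (X ω) ∂P - f y := by
      rw [integral_sub hfi (integrable_const (f y))]; simp
    rw [integral_sub (f := fun ω => f (X ω) - f y) (hfi.sub (integrable_const (f y))) (D.integrable_comp hXy), h2,
      D.integral_comp_comm hXy, h1]
    abel
  rw [e, ← integral_const_mul]
  refine (norm_add_le _ _).trans (add_le_add le_rfl ?_)
  exact norm_integral_le_of_norm_le ((hX.sub (memLp_const y)).norm.integrable_sq.const_mul M)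
    (Filter.Eventually.of_forall fun ω => hrem (X ω))

end Taylor

/-! ### Second moments and bias of the scheme -/

section Moments

variable {Ω : Type*} [MeasurableSpace Ω] {P : Measure Ω} [IsProbabilityMeasure P]
  {F : E d → ℝ} {σ : ℝ → E d → Matrix (Fin d) (Fin d) ℝ} {h : ℝ} {x₀ : E d} {γ : ℕ → Ω → E d}
  {B β μ M : ℝ}

theorem integral_norm_scheme_sub_sq_succ_le (hF : ObjectiveAssumption F)
    (hσ : DiffusionAssumption F σ) (hh : 0 ≤ h) (hγm : ∀ n, Measurable (γ n))
    (hγ : ∀ n, HasLaw (γ n) (stdGaussian (E d)) P) (hind : iIndepFun γ P)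
    (hB : ∀ t, 0 ≤ t → ∀ x, ‖diffusionCLM σ t x‖ ≤ B * (1 + ‖x - minimizer F‖))
    (hβ : 2 * B ^ 2 * (∫ v, ‖v‖ ^ 2 ∂stdGaussian (E d)) ≤ β) (hμ : 0 ≤ μ) (hhμ : h * μ ≤ 1)
    (hT : ∀ x y, ‖eulerStep F h x - eulerStep F h y‖ ≤ (1 - h * μ / 2) * ‖x - y‖)
    (n : ℕ) (y : E d) :
    ∫ ω, ‖scheme F σ h x₀ γ (n + 1) ω - eulerStep F h y‖ ^ 2 ∂P
      ≤ (1 - h * μ / 2) * ∫ ω, ‖scheme F σ h x₀ γ n ω - y‖ ^ 2 ∂P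
        + h ^ 2 * (β * (1 + ∫ ω, ‖scheme F σ h x₀ γ n ω - minimizer F‖ ^ 2 ∂P)) := by
  have ht : (0 : ℝ) ≤ n * h := by positivity
  have hS : 0 ≤ ∫ ω, ‖scheme F σ h x₀ γ n ω - minimizer F‖ ^ 2 ∂P :=
    integral_nonneg fun ω => by positivity
  have h1 : 0 ≤ h * μ := mul_nonneg hh hμ
  have := integral_norm_step_sub_sq_le (hσ.continuous_diffusionCLM ht) (hB _ ht)
    (memLp_two_scheme (x₀ := x₀) hF hσ hh hγm hγ hind hT n) (hγ n)
    (indepFun_scheme hF hσ hh hγm hind n) (contDiff_eulerStep hF h).continuous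
    (by linarith) (by linarith) hT h y
  exact this.trans (by gcongr)

theorem integral_norm_scheme_sub_minimizer_sq_le (hF : ObjectiveAssumption F)
    (hσ : DiffusionAssumption F σ) (hh : 0 ≤ h) (hγm : ∀ n, Measurable (γ n))
    (hγ : ∀ n, HasLaw (γ n) (stdGaussian (E d)) P) (hind : iIndepFun γ P)
    (hB : ∀ t, 0 ≤ t → ∀ x, ‖diffusionCLM σ t x‖ ≤ B * (1 + ‖x - minimizer F‖))
    (hβ : 2 * B ^ 2 * (∫ v, ‖v‖ ^ 2 ∂stdGaussian (E d)) ≤ β) (hμ : 0 ≤ μ) (hhμ : h * μ ≤ 1)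
    (hhβ : h * β ≤ μ / 4)
    (hT : ∀ x y, ‖eulerStep F h x - eulerStep F h y‖ ≤ (1 - h * μ / 2) * ‖x - y‖) (n : ℕ) :
    ∫ ω, ‖scheme F σ h x₀ γ n ω - minimizer F‖ ^ 2 ∂P ≤ 1 + ‖x₀ - minimizer F‖ ^ 2 := by
  refine le_of_contracting_recursion (c := h * μ / 4)
    (a := fun n => ∫ ω, ‖scheme F σ h x₀ γ n ω - minimizer F‖ ^ 2 ∂P) (by linarith) ?_
    (fun n => ?_) n
  · simp [scheme]
  · have h1 := integral_norm_scheme_sub_sq_succ_le (x₀ := x₀) hF hσ hh hγm hγ hind hB hβ hμ hhμ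
      hT n (minimizer F)
    rw [eulerStep_minimizer hF] at h1
    set S := ∫ ω, ‖scheme F σ h x₀ γ n ω - minimizer F‖ ^ 2 ∂P
    have hS : 0 ≤ S := integral_nonneg fun ω => by positivity
    -- Since `hβ ≤ μ/4`, the noise consumes only half of the contraction rate `hμ/2`, leaving
    -- `hμ/4`.
    have h2 : h ^ 2 * (β * (1 + S)) ≤ h * (μ / 4) * (1 + S) := by
      rw [sq, mul_assoc h h, ← mul_assoc h β, mul_assoc h (μ / 4)]
      gcongr
    have h3 : 0 ≤ h * μ * ‖x₀ - minimizer F‖ ^ 2 := by positivity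
    linarith

theorem integral_norm_scheme_sub_iterate_sq_le (hF : ObjectiveAssumption F)
    (hσ : DiffusionAssumption F σ) (hh : 0 ≤ h) (hγm : ∀ n, Measurable (γ n))
    (hγ : ∀ n, HasLaw (γ n) (stdGaussian (E d)) P) (hind : iIndepFun γ P)
    (hB : ∀ t, 0 ≤ t → ∀ x, ‖diffusionCLM σ t x‖ ≤ B * (1 + ‖x - minimizer F‖))
    (hβ : 2 * B ^ 2 * (∫ v, ‖v‖ ^ 2 ∂stdGaussian (E d)) ≤ β) (hβ0 : 0 ≤ β)
    (hμ : 0 < μ) (hhμ : h * μ ≤ 1) (hhβ : h * β ≤ μ / 4)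
    (hT : ∀ x y, ‖eulerStep F h x - eulerStep F h y‖ ≤ (1 - h * μ / 2) * ‖x - y‖) (n : ℕ) :
    ∫ ω, ‖scheme F σ h x₀ γ n ω - (eulerStep F h)^[n] x₀‖ ^ 2 ∂P
      ≤ 4 * β / μ * (1 + ‖x₀ - minimizer F‖ ^ 2) * h := by
  refine le_of_contracting_recursion (c := h * μ / 2)
    (a := fun n => ∫ ω, ‖scheme F σ h x₀ γ n ω - (eulerStep F h)^[n] x₀‖ ^ 2 ∂P) (by linarith) ?_
    (fun n => ?_) n
  · simp only [scheme, Function.iterate_zero, id, sub_self, norm_zero]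
    simp only [ne_eq, OfNat.ofNat_ne_zero, not_false_eq_true, zero_pow, integral_zero]
    positivity
  · have h1 := integral_norm_scheme_sub_sq_succ_le (x₀ := x₀) hF hσ hh hγm hγ hind hB hβ hμ.le
      hhμ hT n ((eulerStep F h)^[n] x₀)
    have hS := integral_norm_scheme_sub_minimizer_sq_le (x₀ := x₀) hF hσ hh hγm hγ hind hB hβ
      hμ.le hhμ hhβ hT n
    rw [← Function.iterate_succ_apply' (eulerStep F h)] at h1
    refine h1.trans (add_le_add le_rfl ?_)
    calc h ^ 2 * (β * (1 + ∫ ω, ‖scheme F σ h x₀ γ n ω - minimizer F‖ ^ 2 ∂P))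
        ≤ h ^ 2 * (β * (1 + (1 + ‖x₀ - minimizer F‖ ^ 2))) := by gcongr
      _ ≤ h ^ 2 * (β * (2 * (1 + ‖x₀ - minimizer F‖ ^ 2))) := by
          gcongr
          linarith [sq_nonneg ‖x₀ - minimizer F‖]
      _ = h * μ / 2 * (4 * β / μ * (1 + ‖x₀ - minimizer F‖ ^ 2) * h) := by field_simp; ring

theorem norm_integral_scheme_sub_iterate_le (hF : ObjectiveAssumption F)
    (hσ : DiffusionAssumption F σ) (hh : 0 ≤ h) (hγm : ∀ n, Measurable (γ n))
    (hγ : ∀ n, HasLaw (γ n) (stdGaussian (E d)) P) (hind : iIndepFun γ P)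
    (hB : ∀ t, 0 ≤ t → ∀ x, ‖diffusionCLM σ t x‖ ≤ B * (1 + ‖x - minimizer F‖))
    (hβ : 2 * B ^ 2 * (∫ v, ‖v‖ ^ 2 ∂stdGaussian (E d)) ≤ β) (hβ0 : 0 ≤ β)
    (hM : ∀ x, ‖iteratedFDeriv ℝ 3 F x‖ ≤ M)
    (hμ : 0 < μ) (hhμ : h * μ ≤ 1) (hhβ : h * β ≤ μ / 4)
    (hT : ∀ x y, ‖eulerStep F h x - eulerStep F h y‖ ≤ (1 - h * μ / 2) * ‖x - y‖) (n : ℕ) :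
    ‖∫ ω, scheme F σ h x₀ γ n ω ∂P - (eulerStep F h)^[n] x₀‖
      ≤ 8 * M * β / μ ^ 2 * (1 + ‖x₀ - minimizer F‖ ^ 2) * h := by
  have hM0 : 0 ≤ M := (norm_nonneg _).trans (hM x₀)
  refine le_of_contracting_recursion (c := h * μ / 2)
    (a := fun n => ‖∫ ω, scheme F σ h x₀ γ n ω ∂P - (eulerStep F h)^[n] x₀‖) (by linarith) ?_
    (fun n => ?_) n
  · simp only [scheme, Function.iterate_zero, id, integral_const, probReal_univ, one_smul,
      sub_self, norm_zero]
    positivity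
  · have ht : (0 : ℝ) ≤ n * h := by positivity
    have hX := memLp_two_scheme (x₀ := x₀) hF hσ hh hγm hγ hind hT n
    have hi := indepFun_scheme (x₀ := x₀) hF hσ hh hγm hind n
    have hrem := norm_taylor_eulerStep_le hF hM hh ((eulerStep F h)^[n] x₀)
    have hTc := (contDiff_eulerStep hF h).continuous
    have hmean : ∫ ω, scheme F σ h x₀ γ (n + 1) ω ∂P
        = ∫ ω, eulerStep F h (scheme F σ h x₀ γ n ω) ∂P := by
      simp_rw [scheme_succ]
      rw [integral_add (g := fun ω => h • diffusionCLM σ (n * h) (scheme F σ h x₀ γ n ω) (γ n ω))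
        (integrable_comp_of_taylor hTc hrem hX) (((memLp_two_apply (hσ.continuous_diffusionCLM ht) (hB _ ht) hX (hγ n) hi).integrable
          one_le_two).smul h), integral_smul,
        integral_apply_eq_zero (hσ.continuous_diffusionCLM ht) (hB _ ht) hX (hγ n) hi, smul_zero,
        add_zero]
    have h1 := norm_integral_comp_sub_le_of_taylor hTc hrem hX
    have hD := norm_fderiv_eulerStep_le (by linarith) hT ((eulerStep F h)^[n] x₀)
    rw [← hmean, ← Function.iterate_succ_apply' (eulerStep F h)] at h1
    -- The derivative of the Euler map contracts the old bias; the quadratic remainder carries a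
    -- factor `h`, and the mean square deviation is itself `O(h)`.
    refine h1.trans (add_le_add ?_ ?_)
    · exact ((fderiv ℝ (eulerStep F h) _).le_opNorm _).trans (by gcongr)
    · calc h * M * ∫ ω, ‖scheme F σ h x₀ γ n ω - (eulerStep F h)^[n] x₀‖ ^ 2 ∂P
          ≤ h * M * (4 * β / μ * (1 + ‖x₀ - minimizer F‖ ^ 2) * h) := by
            gcongr
            exact integral_norm_scheme_sub_iterate_sq_le hF hσ hh hγm hγ hind hB hβ hβ0 hμ hhμ
              hhβ hT n
        _ = h * μ / 2 * (8 * M * β / μ ^ 2 * (1 + ‖x₀ - minimizer F‖ ^ 2) * h) := by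
            field_simp; ring

end Moments

/-! ### Test functions on a ball around the minimizer, and the final constant -/

theorem norm_fderiv_le_gradient_add_tripleNorm {φ : E d → ℝ} (hφ : ContDiff ℝ 2 φ)
    (hφb : BoundedDeriv 2 φ) {z x : E d} {r : ℝ} (hx : ‖x - z‖ ≤ r) :
    ‖fderiv ℝ φ x‖ ≤ ‖gradient φ z‖ + tripleNorm 2 φ * r := by
  have hT : 0 ≤ tripleNorm 2 φ :=
    (norm_nonneg _).trans (hφb.norm_iteratedFDeriv_le_tripleNorm x)
  rw [norm_gradient_eq_norm_fderiv]
  have h1 := norm_fderiv_sub_le_of_norm_iteratedFDeriv_two_le hφ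
    hφb.norm_iteratedFDeriv_le_tripleNorm z x
  have h2 : tripleNorm 2 φ * ‖x - z‖ ≤ tripleNorm 2 φ * r := by gcongr
  linarith [norm_le_norm_add_norm_sub' (fderiv ℝ φ x) (fderiv ℝ φ z)]

theorem abs_sub_le_of_norm_sub_le {φ : E d → ℝ} (hφ : ContDiff ℝ 2 φ)
    (hφb : BoundedDeriv 2 φ) {z x y : E d} {r : ℝ} (hx : ‖x - z‖ ≤ r) (hy : ‖y - z‖ ≤ r) :
    |φ y - φ x| ≤ (‖gradient φ z‖ + tripleNorm 2 φ * r) * ‖y - x‖ :=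
  (convex_closedBall z r).norm_image_sub_le_of_norm_fderiv_le (𝕜 := ℝ)
    (fun u _ => hφ.differentiable (by norm_num) u)
    (fun u hu => norm_fderiv_le_gradient_add_tripleNorm hφ hφb
      (by rwa [Metric.mem_closedBall, dist_eq_norm] at hu))
    (by rwa [Metric.mem_closedBall, dist_eq_norm]) (by rwa [Metric.mem_closedBall, dist_eq_norm])

/-- The cubic growth comes from `(1 + r)(1 + r²)`: a gradient of linear growth times a bias of
quadratic growth. -/
theorem weak_error_bound_le {G T r h K₁ K₂ K₃ : ℝ} (hG : 0 ≤ G) (hT : 0 ≤ T) (hr : 0 ≤ r)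
    (hh : 0 ≤ h) (h₁ : 0 ≤ K₁) (h₂ : 0 ≤ K₂) (h₃ : 0 ≤ K₃) :
    (G + T * r) * (K₂ * (1 + r ^ 2) * h) + T * (K₁ * (1 + r ^ 2) * h)
        + (G + T * r) * (K₃ * r * h)
      ≤ (4 * (K₁ + K₂ + K₃) + 1) * (G + T) * (1 + r ^ 3) * h := by
  have hr1 : r ≤ 1 + r ^ 3 := by nlinarith [sq_nonneg (r - 1), pow_nonneg hr 3]
  have hr2 : r ^ 2 ≤ 1 + r ^ 3 := by nlinarith [mul_nonneg hr (sq_nonneg (r - 1))]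
  have hr3 : 0 ≤ r ^ 3 := pow_nonneg hr 3
  have hGT : G + T * r ≤ (G + T) * (1 + r) := by nlinarith [mul_nonneg hG hr]
  have e1 : (1 + r) * (1 + r ^ 2) ≤ 4 * (1 + r ^ 3) := by nlinarith
  have e2 : 1 + r ^ 2 ≤ 4 * (1 + r ^ 3) := by linarith
  have e3 : (1 + r) * r ≤ 4 * (1 + r ^ 3) := by nlinarith
  have hGT0 : 0 ≤ G + T := add_nonneg hG hT
  calc (G + T * r) * (K₂ * (1 + r ^ 2) * h) + T * (K₁ * (1 + r ^ 2) * h)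
        + (G + T * r) * (K₃ * r * h)
      ≤ (G + T) * (1 + r) * (K₂ * (1 + r ^ 2) * h) + (G + T) * (K₁ * (1 + r ^ 2) * h)
        + (G + T) * (1 + r) * (K₃ * r * h) := by
          gcongr
          linarith
    _ = (G + T) * h * (K₂ * ((1 + r) * (1 + r ^ 2)) + K₁ * (1 + r ^ 2) + K₃ * ((1 + r) * r)) := by
          ring
    _ ≤ (G + T) * h * (K₂ * (4 * (1 + r ^ 3)) + K₁ * (4 * (1 + r ^ 3))
        + K₃ * (4 * (1 + r ^ 3))) := by gcongr
    _ ≤ (G + T) * h * (K₂ * (4 * (1 + r ^ 3)) + K₁ * (4 * (1 + r ^ 3))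
        + K₃ * (4 * (1 + r ^ 3)) + (1 + r ^ 3)) := by 
        gcongr ?_ * ?_
        linarith
    _ = _ := by ring

end StochGradScheme

theorem proposition4p2 {d : ℕ} (hd : 0 < d) (hmax : ℝ) (hmax_pos : 0 < hmax)
    (F : E d → ℝ) (σ : ℝ → E d → Matrix (Fin d) (Fin d) ℝ)
    (hF : ObjectiveAssumption F) (hσ : DiffusionAssumption F σ) :
    ∃ H ∈ Set.Ioo 0 hmax, ∃ C : ℝ, 0 < C ∧
      ∀ φ : E d → ℝ, ContDiff ℝ 2 φ → BoundedDeriv 2 φ → ∀ x₀ : E d, ∀ h ∈ Set.Ioo 0 H,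
      ∀ (Ω : Type*) [MeasurableSpace Ω] (P : Measure Ω) [IsProbabilityMeasure P]
        (γ : ℕ → Ω → E d), (∀ n, Measurable (γ n)) →
        (∀ n, HasLaw (γ n) (stdGaussian (E d)) P) → iIndepFun γ P →
      ∀ N : ℕ, 1 ≤ N →
        Integrable (fun ω => φ (scheme F σ h x₀ γ N ω)) P ∧
        |(∫ ω, φ (scheme F σ h x₀ γ N ω) ∂P) - φ (gradientFlow F x₀ (N * h))|
          ≤ weakConst F C φ x₀ * h := by
  obtain ⟨L, hL, hLip⟩ := hF.lipschitz_gradient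
  obtain ⟨μ, hμ, hconv⟩ := hF.mu_convex
  obtain ⟨M, hM⟩ := hF.bounded_third
  have hM0 : 0 ≤ M := (norm_nonneg _).trans (hM 0)
  obtain ⟨B, hB⟩ := hσ.exists_norm_diffusionCLM_le
  -- Adding `1` keeps `β` positive even for vanishing noise; otherwise `μ / 4 / β` could be `0` and
  -- no step size would remain.
  obtain ⟨β, hβ0, hβ⟩ : ∃ β : ℝ, 0 < β ∧
      2 * B ^ 2 * (∫ v, ‖v‖ ^ 2 ∂stdGaussian (E d)) ≤ β := by
    have hκ : 0 ≤ ∫ v, ‖v‖ ^ 2 ∂stdGaussian (E d) := integral_nonneg fun v => by positivity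
    exact ⟨2 * B ^ 2 * (∫ v, ‖v‖ ^ 2 ∂stdGaussian (E d)) + 1, by positivity, by linarith⟩
  -- The entries give, in order, `H < hmax`, the two conditions `hL² ≤ μ` and `hμ ≤ 1` for
  -- contraction, and `hβ ≤ μ/4` for bounded moments. The three terms of `C` stem from the mean
  -- square deviation, the bias and the Euler error.
  refine ⟨min (hmax / 2) (min (μ / L ^ 2) (min (1 / μ) (μ / 4 / β))),
    ⟨by positivity, (min_le_left _ _).trans_lt (by linarith)⟩,
    4 * (4 * β / μ + 8 * M * β / μ ^ 2 + 2 * L ^ 2 / μ) + 1, by positivity, ?_⟩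
  intro φ hφ hφb x₀ h hh Ω _ P _ γ hγm hγ hind N _
  obtain ⟨hh0, hhH⟩ := hh
  simp only [lt_min_iff] at hhH
  obtain ⟨-, hhL, hhμ, hhβ⟩ := hhH
  rw [lt_div_iff₀ (by positivity)] at hhL hhμ hhβ
  have hT := norm_eulerStep_sub_le hLip hconv hh0.le hhL.le hhμ.le
  have hX := memLp_two_scheme (x₀ := x₀) hF hσ hh0.le hγm hγ hind hT N
  set Y := (eulerStep F h)^[N] x₀ with hY
  set r := ‖x₀ - minimizer F‖ with hr
  have hT0 : 0 ≤ tripleNorm 2 φ :=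
    (norm_nonneg _).trans (hφb.norm_iteratedFDeriv_le_tripleNorm Y)
  have hrem := norm_taylor_one_le_of_norm_iteratedFDeriv_two_le hφ
    hφb.norm_iteratedFDeriv_le_tripleNorm Y
  refine ⟨integrable_comp_of_taylor hφ.continuous hrem hX, ?_⟩
  have hYr : ‖Y - minimizer F‖ ≤ r :=
    norm_iterate_sub_le (by nlinarith) hT (eulerStep_minimizer hF h) x₀ N
  have hXr : ‖gradientFlow F x₀ (N * h) - minimizer F‖ ≤ r :=
    (isGradientFlow_gradientFlow hF x₀).norm_sub_minimizer_le hF (by positivity)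
  have hnoise : |(∫ ω, φ (scheme F σ h x₀ γ N ω) ∂P) - φ Y|
      ≤ (‖gradient φ (minimizer F)‖ + tripleNorm 2 φ * r)
          * (8 * M * β / μ ^ 2 * (1 + r ^ 2) * h)
        + tripleNorm 2 φ * (4 * β / μ * (1 + r ^ 2) * h) := by
    refine (norm_integral_comp_sub_le_of_taylor hφ.continuous hrem hX).trans ?_
    refine add_le_add (((fderiv ℝ φ Y).le_opNorm _).trans ?_) ?_
    · gcongr
      · exact norm_fderiv_le_gradient_add_tripleNorm hφ hφb hYr
      · exact norm_integral_scheme_sub_iterate_le hF hσ hh0.le hγm hγ hind hB hβ hβ0.le hM hμ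
          hhμ.le hhβ.le hT N
    · gcongr
      exact integral_norm_scheme_sub_iterate_sq_le hF hσ hh0.le hγm hγ hind hB hβ hβ0.le hμ
        hhμ.le hhβ.le hT N
  have hflow : |φ Y - φ (gradientFlow F x₀ (N * h))|
      ≤ (‖gradient φ (minimizer F)‖ + tripleNorm 2 φ * r) * (2 * L ^ 2 / μ * r * h) := by
    refine (abs_sub_le_of_norm_sub_le hφ hφb hXr hYr).trans ?_
    gcongr
    exact norm_iterate_eulerStep_sub_gradientFlow_le hF hL.le hμ hh0 hhμ.le hLip hT x₀ N
  refine (abs_sub_le _ (φ Y) _).trans ((add_le_add hnoise hflow).trans ?_)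
  have hK₁ : 0 ≤ 4 * β / μ := by positivity
  have hK₂ : 0 ≤ 8 * M * β / μ ^ 2 := by positivity
  have hK₃ : 0 ≤ 2 * L ^ 2 / μ := by positivity
  rw [weakConst, ← hr]
  have hG0 : 0 ≤ ‖gradient φ (minimizer F)‖ := norm_nonneg _
  have hr0 : 0 ≤ r := norm_nonneg _
  exact weak_error_bound_le hG0 hT0 hr0 hh0.le hK₁ hK₂ hK₃
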